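/- Let $n \ge 4$, $a \in \mathbb{Z}^n$, $b \in \mathbb{Z}$, and let $P = \{x \in [0,1]^n : a^{T}x \le b\}$. Then there exists an integral matrix $W \in \mathbb{Z}^{(n-2)\times n}$ such that $$\operatorname{conv}(P \cap \mathbb{Z}^n) = \operatorname{conv}\left(\{x \in P : Wx \in \mathbb{Z}^{n-2}\}\right).$$ -/

import Mathlib

/-- The integer lattice `ℤᵏ`, as a subset of `ℝᵏ`. -/
def intLattice (ι : Type*) : Set (ι → ℝ) :=
  {x | ∀ i, ∃ z : ℤ, x i = (z : ℝ)}

/-- The mixed integer reformulation property of a set `P ⊆ ℝⁿ` and an integral `k × n` matrix `W`: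
`conv (P ∩ ℤⁿ) = conv {x ∈ P | W x ∈ ℤᵏ}`. -/
def MixedIntegerProperty {k n : ℕ} (P : Set (Fin n → ℝ)) (W : Matrix (Fin k) (Fin n) ℤ) : Prop :=
  convexHull ℝ (P ∩ intLattice (Fin n)) =
    convexHull ℝ {x | x ∈ P ∧ (W.map (Int.cast : ℤ → ℝ)).mulVec x ∈ intLattice (Fin k)}

/-- The linear relaxation `{x ∈ [0,1]ⁿ | aᵀ x ≤ b}` of a 0-1 knapsack problem. -/
def knapsackPolytope {n : ℕ} (a : Fin n → ℤ) (b : ℤ) : Set (Fin n → ℝ) :=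
  {x | (∀ i, x i ∈ Set.Icc (0 : ℝ) 1) ∧ ∑ i, (a i : ℝ) * x i ≤ (b : ℝ)}

/-!
Write `F` for the family of sets `S` with `∑ i ∈ S, a i ≤ b`; these are the integral points of the
knapsack polytope. A different weight vector `c` may describe the same family: it does as soon as
`∑ i ∈ S, c i ≤ β` for `S ∈ F` and `∑ i ∈ S, c i ≥ β + 1` for `S ∉ F`. These inequalities in the
`n + 1` unknowns `(c, β)` define a nonempty polyhedron without lines, which has a point where at
least `n + 1 ≥ 5` of them are tight (`exists_feasible_finrank_le_card_tight`). Hence three of the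
tight ones are of the same kind, so that three distinct sets `S₁, S₂, S₃` have the same `c`-weight
(`exists_separating_weight`).

Let `p = 1_{S₁} - 1_{S₃}` and `q = 1_{S₂} - 1_{S₃}`. There is an integral matrix `W` with `n - 2`
rows such that `W x` is integral only for `x ∈ ℤⁿ + span(p, q)` (`exists_matrix_of_directions`).
The entries of `p`, `q` and `p - q` lie in `{-1, 0, 1}`, and therefore every such `x` in the cube is
a convex combination of `0/1`-points of the plane `x + span(p, q)`
(`exists_binary_convex_combination`). As `c` is orthogonal to `p` and `q`, these points have the
same `c`-weight, so they all belong to `F` or all lie outside `F`. The second case is impossible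
when `a · x ≤ b`, and in the first case `x` lies in the integer hull.
-/

/-! ### Vertices of polyhedra and separating weights -/

/-- A nonempty polyhedron `{w | ∀ i, r i ≤ ℓ i w}` containing no line has a point at which at least
as many constraints are tight as the dimension of the space. -/
theorem exists_feasible_finrank_le_card_tight {E ι : Type*} [AddCommGroup E] [Module ℝ E]
    [FiniteDimensional ℝ E] [Fintype ι] (ℓ : ι → E →ₗ[ℝ] ℝ) (r : ι → ℝ)
    (hsep : ∀ h, (∀ i, ℓ i h = 0) → h = 0) (w₀ : E) (hw₀ : ∀ i, r i ≤ ℓ i w₀) :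
    ∃ w, (∀ i, r i ≤ ℓ i w) ∧
      Module.finrank ℝ E ≤ (Finset.univ.filter fun i => ℓ i w = r i).card := by
  classical
  let tight : E → Finset ι := fun w => Finset.univ.filter fun i => ℓ i w = r i
  obtain ⟨w, hw, hmax⟩ : ∃ w, (∀ i, r i ≤ ℓ i w) ∧
      ∀ w', (∀ i, r i ≤ ℓ i w') → (tight w').card ≤ (tight w).card := by
    have hbdd : ∀ k ∈ {k | ∃ w, (∀ i, r i ≤ ℓ i w) ∧ (tight w).card = k},
        k ≤ Fintype.card ι := by
      rintro _ ⟨w, -, rfl⟩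
      exact Finset.card_le_univ _
    obtain ⟨w, hw, hk⟩ := Nat.sSup_mem (s := {k | ∃ w, (∀ i, r i ≤ ℓ i w) ∧ (tight w).card = k})
      ⟨_, w₀, hw₀, rfl⟩ ⟨_, hbdd⟩
    exact ⟨w, hw, fun w' hw' => hk ▸ le_csSup ⟨_, hbdd⟩ ⟨w', hw', rfl⟩⟩
  refine ⟨w, hw, ?_⟩
  by_contra! hlt
  obtain ⟨h, hker, hne⟩ : ∃ h : E, (∀ i ∈ tight w, ℓ i h = 0) ∧ h ≠ 0 := by
    let φ : E →ₗ[ℝ] (tight w → ℝ) := LinearMap.pi fun i => ℓ i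
    have hφ : LinearMap.ker φ ≠ ⊥ := by
      apply LinearMap.ker_ne_bot_of_finrank_lt
      simpa using hlt
    obtain ⟨h, hh, hne⟩ := Submodule.exists_mem_ne_zero_of_ne_bot hφ
    exact ⟨h, fun i hi => congrFun (LinearMap.mem_ker.1 hh) ⟨i, hi⟩, hne⟩
  obtain ⟨h, hker, i₀, hi₀⟩ : ∃ h : E, (∀ i ∈ tight w, ℓ i h = 0) ∧ ∃ i, ℓ i h < 0 := by
    obtain ⟨i, hi⟩ : ∃ i, ℓ i h ≠ 0 := by
      by_contra! hall
      exact hne (hsep h hall)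
    rcases lt_or_gt_of_ne hi with hi | hi
    · exact ⟨h, hker, i, hi⟩
    · exact ⟨-h, fun j hj => by simp [hker j hj], i, by simpa using hi⟩
  -- Move from `w` in direction `h` until the first constraint not yet tight becomes tight.
  obtain ⟨j, hj, hmin⟩ := (Finset.univ.filter fun i => ℓ i h < 0).exists_min_image
    (fun i => (ℓ i w - r i) / (-ℓ i h)) ⟨i₀, by simpa using hi₀⟩
  have hj' : ℓ j h < 0 := by simpa using hj
  set t := (ℓ j w - r j) / (-ℓ j h) with ht
  have ht0 : 0 ≤ t := div_nonneg (sub_nonneg.2 (hw j)) (by linarith)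
  have hfeas : ∀ i, r i ≤ ℓ i (w + t • h) := by
    intro i
    rw [map_add, map_smul, smul_eq_mul]
    rcases lt_or_ge (ℓ i h) 0 with hi | hi
    · have := hmin i (by simpa using hi)
      rw [le_div_iff₀ (by linarith)] at this
      linarith
    · nlinarith [hw i, mul_nonneg ht0 hi]
  have hsub : insert j (tight w) ⊆ tight (w + t • h) := by
    intro i hi
    rcases Finset.mem_insert.1 hi with rfl | hi
    · simp only [tight, Finset.mem_filter, Finset.mem_univ, true_and, map_add, map_smul,
        smul_eq_mul]
      rw [ht]
      field_simp [hj'.ne]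
      ring
    · have h0 := hker i hi
      simp only [tight, Finset.mem_filter, Finset.mem_univ, true_and] at hi
      simp [tight, h0, hi]
  have hjt : j ∉ tight w := fun hjt => hj'.ne (hker j hjt)
  have h1 := Finset.card_le_card hsub
  rw [Finset.card_insert_of_notMem hjt] at h1
  have h2 := hmax _ hfeas
  omega

/-- A family of sets that is cut out by a weight threshold can also be cut out by a weight `c` for
which three distinct sets have equal weight. -/
theorem exists_separating_weight {n : ℕ} (hn : 4 ≤ n) (a : Fin n → ℤ) (b : ℤ) :
    ∃ c : Fin n → ℝ,
      (∀ S T : Finset (Fin n), ∑ i ∈ S, c i = ∑ i ∈ T, c i →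
        ∑ i ∈ S, a i ≤ b → ∑ i ∈ T, a i ≤ b) ∧
      ∃ S₁ S₂ S₃ : Finset (Fin n), S₁ ≠ S₂ ∧ S₁ ≠ S₃ ∧ S₂ ≠ S₃ ∧
        ∑ i ∈ S₁, c i = ∑ i ∈ S₃, c i ∧ ∑ i ∈ S₂, c i = ∑ i ∈ S₃, c i := by
  classical
  let ev : Finset (Fin n) → ((Fin n → ℝ) × ℝ) →ₗ[ℝ] ℝ := fun S =>
    (∑ i ∈ S, LinearMap.proj i) ∘ₗ LinearMap.fst ℝ _ _ - LinearMap.snd ℝ _ _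
  have hev : ∀ S w, ev S w = ∑ i ∈ S, w.1 i - w.2 := fun S w => by simp [ev]
  let F : Finset (Fin n) → Prop := fun S => ∑ i ∈ S, a i ≤ b
  obtain ⟨w, hw, hcard⟩ := exists_feasible_finrank_le_card_tight
    (fun S => if F S then -ev S else ev S) (fun S => if F S then 0 else 1)
    (by
      intro h hh
      have h0 : ∀ S, ev S h = 0 := fun S => by
        have := hh S
        split_ifs at this <;> simpa using this
      have hβ : h.2 = 0 := by simpa [hev] using h0 ∅
      refine Prod.ext (funext fun i => ?_) hβ
      simpa [hev, hβ] using h0 {i})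
    (fun i => (a i : ℝ), (b : ℝ))
    (by
      intro S
      by_cases hS : F S
      · have : (∑ i ∈ S, (a i : ℝ)) ≤ b := by exact_mod_cast hS
        simpa [hS, hev] using this
      · have h1 : b + 1 ≤ ∑ i ∈ S, a i := by simpa [F, Int.add_one_le_iff] using hS
        have : (b : ℝ) + 1 ≤ ∑ i ∈ S, (a i : ℝ) := by exact_mod_cast h1
        simp only [hS, if_false, hev]
        linarith)
  have hF : ∀ S, F S → ∑ i ∈ S, w.1 i ≤ w.2 := fun S hS => by simpa [hS, hev] using hw S
  have hF' : ∀ S, ¬ F S → w.2 + 1 ≤ ∑ i ∈ S, w.1 i := fun S hS => by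
    have := hw S
    simp only [hS, if_false, hev] at this
    linarith
  refine ⟨w.1, fun S T hST hS => ?_, ?_⟩
  · by_contra hT
    linarith [hF S hS, hF' T hT]
  set t := Finset.univ.filter fun S => (if F S then -ev S else ev S) w = if F S then (0 : ℝ) else 1
    with ht
  -- Five tight constraints: three of them concern members of `F`, or three concern non-members.
  have h5 : 5 ≤ (t.filter F).card + (t.filter fun S => ¬ F S).card := by
    rw [Finset.card_filter_add_card_filter_not]
    have : Module.finrank ℝ ((Fin n → ℝ) × ℝ) = n + 1 := by simp
    omega
  have key : ∀ (u : Finset (Finset (Fin n))) (v : ℝ), (∀ S ∈ u, ∑ i ∈ S, w.1 i = v) → 2 < u.card →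
      ∃ S₁ S₂ S₃ : Finset (Fin n), S₁ ≠ S₂ ∧ S₁ ≠ S₃ ∧ S₂ ≠ S₃ ∧
        ∑ i ∈ S₁, w.1 i = ∑ i ∈ S₃, w.1 i ∧ ∑ i ∈ S₂, w.1 i = ∑ i ∈ S₃, w.1 i := by
    intro u v hu h2
    obtain ⟨S₁, S₂, S₃, h₁, h₂, h₃, h12, h13, h23⟩ := Finset.two_lt_card_iff.1 h2
    exact ⟨S₁, S₂, S₃, h12, h13, h23, by rw [hu _ h₁, hu _ h₃], by rw [hu _ h₂, hu _ h₃]⟩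
  by_cases h3 : 2 < (t.filter F).card
  · refine key _ w.2 (fun S hS => ?_) h3
    obtain ⟨hS, hFS⟩ := Finset.mem_filter.1 hS
    have := (Finset.mem_filter.1 hS).2
    simp only [hFS, if_true, LinearMap.neg_apply, hev] at this
    linarith
  · refine key (t.filter fun S => ¬ F S) (w.2 + 1) (fun S hS => ?_) (by omega)
    obtain ⟨hS, hFS⟩ := Finset.mem_filter.1 hS
    have := (Finset.mem_filter.1 hS).2
    simp only [hFS, if_false, hev] at this
    linarith

/-! ### Integral matrices with a prescribed two-dimensional kernel -/

/-- If `(p i, q i) = (±1, 0)` and `(p j, q j) = (0, ±1)` for two coordinates `i`, `j`, there is an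
integral matrix with `n - 2` rows that is integral on a point only if this point lies in
`ℤⁿ + span(p, q)`. -/
theorem exists_matrix_of_directions {n : ℕ} (p q : Fin n → ℤ) (i j : Fin n)
    (hpi : p i * p i = 1) (hqi : q i = 0) (hpj : p j = 0) (hqj : q j * q j = 1) :
    ∃ W : Matrix (Fin (n - 2)) (Fin n) ℤ, ∀ x : Fin n → ℝ,
      (W.map (Int.cast : ℤ → ℝ)).mulVec x ∈ intLattice (Fin (n - 2)) →
      ∃ (z : Fin n → ℤ) (s t : ℝ), ∀ k, x k = z k + s * p k + t * q k := by
  classical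
  have hij : i ≠ j := by
    rintro rfl
    simp [hqi] at hqj
  have hcard : Fintype.card (Fin (n - 2)) = Fintype.card {k : Fin n // k ∉ ({i, j} : Finset _)} := by
    rw [Fintype.card_subtype_compl, Fintype.card_coe, Finset.card_pair hij]
    simp
  let e := Fintype.equivOfCardEq hcard
  -- The row of `k ≠ i, j` is `x k - p k * s - q k * t`, with `s = p i * x i` and `t = q j * x j`.
  refine ⟨Matrix.of fun m k => (if k = e m then 1 else 0) - (if k = i then p (e m) * p i else 0)
    - (if k = j then q (e m) * q j else 0), fun x hx => ?_⟩
  have hrow : ∀ k : Fin n, ∃ z : ℤ, x k - p k * (p i * x i) - q k * (q j * x j) = z := by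
    intro k
    by_cases hki : k = i
    · subst hki
      have : (p k : ℝ) * p k = 1 := by exact_mod_cast hpi
      exact ⟨0, by rw [hqi]; push_cast; linear_combination (-x k) * this⟩
    by_cases hkj : k = j
    · subst hkj
      have : (q k : ℝ) * q k = 1 := by exact_mod_cast hqj
      exact ⟨0, by rw [hpj]; push_cast; linear_combination (-x k) * this⟩
    obtain ⟨z, hz⟩ := hx (e.symm ⟨k, by simp [hki, hkj]⟩)
    refine ⟨z, hz ▸ ?_⟩
    simp [Matrix.mulVec, dotProduct, sub_mul, Finset.sum_sub_distrib, Int.cast_ite]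
    ring
  choose z hz using hrow
  exact ⟨z, p i * x i, q j * x j, fun k => by linarith [hz k]⟩


/-! ### Convex combinations of binary points in a plane -/

/-- Convex weights on integers that pairwise differ by at most one and average to a point of `[0,1]`
are supported on `{0, 1}`. -/
theorem eq_zero_or_one_of_average_mem_Icc {ι : Type*} [Fintype ι] (l : ι → ℝ) (m : ι → ℤ)
    (hl : ∀ k, 0 ≤ l k) (hl1 : ∑ k, l k = 1) (hm : ∀ k k', m k - m k' ≤ 1)
    (h0 : 0 ≤ ∑ k, l k * m k) (h1 : ∑ k, l k * m k ≤ 1) (k : ι) (hk : 0 < l k) :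
    m k = 0 ∨ m k = 1 := by
  have hlow : 0 ≤ m k := by
    by_contra! hneg
    have : ∑ k', l k' * m k' < ∑ k' : ι, (0 : ℝ) := by
      refine Finset.sum_lt_sum (fun k' _ => ?_) ⟨k, Finset.mem_univ _, ?_⟩
      · have : (m k' : ℝ) ≤ 0 := by exact_mod_cast (by linarith [hm k' k] : m k' ≤ 0)
        exact mul_nonpos_of_nonneg_of_nonpos (hl k') this
      · exact mul_neg_of_pos_of_neg hk (by exact_mod_cast hneg)
    simp at this
    linarith
  have hup : m k ≤ 1 := by
    by_contra! hgt
    have : ∑ k', l k' < ∑ k', l k' * m k' := by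
      refine Finset.sum_lt_sum (fun k' _ => ?_) ⟨k, Finset.mem_univ _, ?_⟩
      · have : (1 : ℝ) ≤ m k' := by exact_mod_cast (by linarith [hm k k'] : 1 ≤ m k')
        nlinarith [hl k']
      · have : (1 : ℝ) < m k := by exact_mod_cast hgt
        nlinarith
    linarith
  omega

/-- Every point of the plane is a convex combination of three lattice points, the vertices of a
triangle of the standard triangulation, whose edges have the directions `(1,0)`, `(0,1)` and
`(1,-1)`. -/
theorem exists_lattice_triangle (s t : ℝ) :
    ∃ (l : Fin 3 → ℝ) (u v : Fin 3 → ℤ), (∀ k, 0 ≤ l k) ∧ ∑ k, l k = 1 ∧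
      s = ∑ k, l k * u k ∧ t = ∑ k, l k * v k ∧
      ∀ p q : ℤ, |p| ≤ 1 → |q| ≤ 1 → |p - q| ≤ 1 →
        ∀ k k', (u k * p + v k * q) - (u k' * p + v k' * q) ≤ 1 := by
  have hs0 := Int.fract_nonneg s
  have ht0 := Int.fract_nonneg t
  have hs1 := Int.fract_lt_one s
  have ht1 := Int.fract_lt_one t
  have hs := Int.floor_add_fract s
  have ht := Int.floor_add_fract t
  rcases le_total (Int.fract s + Int.fract t) 1 with h | h
  · refine ⟨![1 - Int.fract s - Int.fract t, Int.fract s, Int.fract t],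
      ![⌊s⌋, ⌊s⌋ + 1, ⌊s⌋], ![⌊t⌋, ⌊t⌋, ⌊t⌋ + 1], ?_, ?_, ?_, ?_, ?_⟩
    · intro k
      fin_cases k <;> simp <;> linarith
    · simp [Fin.sum_univ_three]
      ring
    · simp [Fin.sum_univ_three]
      linarith
    · simp [Fin.sum_univ_three]
      linarith
    · intro p q hp hq hpq k k'
      rw [abs_le] at hp hq hpq
      fin_cases k <;> fin_cases k' <;> simp <;> linarith
  · refine ⟨![Int.fract s + Int.fract t - 1, 1 - Int.fract t, 1 - Int.fract s],
      ![⌊s⌋ + 1, ⌊s⌋ + 1, ⌊s⌋], ![⌊t⌋ + 1, ⌊t⌋, ⌊t⌋ + 1], ?_, ?_, ?_, ?_, ?_⟩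
    · intro k
      fin_cases k <;> simp <;> linarith
    · simp [Fin.sum_univ_three]
    · simp [Fin.sum_univ_three]
      linarith
    · simp [Fin.sum_univ_three]
      linarith
    · intro p q hp hq hpq k k'
      rw [abs_le] at hp hq hpq
      fin_cases k <;> fin_cases k' <;> simp <;> linarith

/-- If `p`, `q` and `p - q` have entries in `{-1, 0, 1}`, a point of the cube in `ℤⁿ + span(p, q)` is
a convex combination of binary points that differ from each other by integral combinations of `p`
and `q`. -/
theorem exists_binary_convex_combination {n : ℕ} (p q z : Fin n → ℤ)
    (hp : ∀ i, |p i| ≤ 1) (hq : ∀ i, |q i| ≤ 1) (hpq : ∀ i, |p i - q i| ≤ 1)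
    (x : Fin n → ℝ) (s t : ℝ) (hx : ∀ i, x i = z i + s * p i + t * q i)
    (hx01 : ∀ i, x i ∈ Set.Icc (0 : ℝ) 1) :
    ∃ (l : Fin 3 → ℝ) (u v : Fin 3 → ℤ), (∀ k, 0 ≤ l k) ∧ ∑ k, l k = 1 ∧
      (∀ i, x i = ∑ k, l k * ((z i + u k * p i + v k * q i : ℤ) : ℝ)) ∧
      ∀ k, 0 < l k → ∀ i, z i + u k * p i + v k * q i = 0 ∨ z i + u k * p i + v k * q i = 1 := by
  obtain ⟨l, u, v, hl, hl1, hs, ht, huv⟩ := exists_lattice_triangle s t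
  have hsum : ∀ i, x i = ∑ k, l k * ((z i + u k * p i + v k * q i : ℤ) : ℝ) := by
    intro i
    rw [hx, hs, ht]
    simp only [Fin.sum_univ_three] at hl1 ⊢
    push_cast
    linear_combination (-(z i : ℝ)) * hl1
  refine ⟨l, u, v, hl, hl1, hsum, fun k hk i => ?_⟩
  refine eq_zero_or_one_of_average_mem_Icc l (fun k => z i + u k * p i + v k * q i) hl hl1
    (fun k k' => ?_) (hsum i ▸ (hx01 i).1) (hsum i ▸ (hx01 i).2) k hk
  linarith [huv (p i) (q i) (hp i) (hq i) (hpq i) k k']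

/-! ### The reformulation -/

/-- The reformulation from three sets of equal `c`-weight, when a coordinate `i` tells the first and
a coordinate `j` the second of them apart from the other two. -/
theorem exists_reformulation_of_equal_weight {n : ℕ} (a : Fin n → ℤ) (b : ℤ) (c : Fin n → ℝ)
    (hc : ∀ S T : Finset (Fin n), ∑ i ∈ S, c i = ∑ i ∈ T, c i →
      ∑ i ∈ S, a i ≤ b → ∑ i ∈ T, a i ≤ b)
    (S₁ S₂ S₃ : Finset (Fin n)) (h13 : ∑ i ∈ S₁, c i = ∑ i ∈ S₃, c i)
    (h23 : ∑ i ∈ S₂, c i = ∑ i ∈ S₃, c i) (i j : Fin n)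
    (hi1 : ¬ (i ∈ S₁ ↔ i ∈ S₃)) (hi2 : i ∈ S₂ ↔ i ∈ S₃)
    (hj1 : j ∈ S₁ ↔ j ∈ S₃) (hj2 : ¬ (j ∈ S₂ ↔ j ∈ S₃)) :
    ∃ W : Matrix (Fin (n - 2)) (Fin n) ℤ, MixedIntegerProperty (knapsackPolytope a b) W := by
  classical
  let χ : Finset (Fin n) → Fin n → ℤ := fun S k => if k ∈ S then 1 else 0
  have hχ : ∀ S T k, |χ S k - χ T k| ≤ 1 := by
    intro S T k
    simp only [χ]
    split_ifs <;> simp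
  have hχc : ∀ S, ∑ k, c k * (χ S k : ℝ) = ∑ k ∈ S, c k := by
    intro S
    simp [χ]
  let p : Fin n → ℤ := fun k => χ S₁ k - χ S₃ k
  let q : Fin n → ℤ := fun k => χ S₂ k - χ S₃ k
  have hcp : ∑ k, c k * (p k : ℝ) = 0 := by
    simp only [p, Int.cast_sub, mul_sub, Finset.sum_sub_distrib, hχc, h13, sub_self]
  have hcq : ∑ k, c k * (q k : ℝ) = 0 := by
    simp only [q, Int.cast_sub, mul_sub, Finset.sum_sub_distrib, hχc, h23, sub_self]
  obtain ⟨W, hW⟩ := exists_matrix_of_directions p q i j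
    (by by_cases h : i ∈ S₁ <;> by_cases h' : i ∈ S₃ <;> simp_all [p, χ])
    (by simp [q, χ, hi2]) (by simp [p, χ, hj1])
    (by by_cases h : j ∈ S₂ <;> by_cases h' : j ∈ S₃ <;> simp_all [q, χ])
  refine ⟨W, Set.Subset.antisymm (convexHull_mono ?_)
    (convexHull_min ?_ (convex_convexHull ℝ _))⟩
  · rintro x ⟨hxP, hx⟩
    refine ⟨hxP, fun m => ?_⟩
    choose z hz using hx
    exact ⟨∑ k, W m k * z k, by simp [Matrix.mulVec, dotProduct, hz]⟩
  rintro x ⟨⟨hx01, hxa⟩, hx⟩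
  obtain ⟨z, s, t, hzst⟩ := hW x hx
  obtain ⟨l, u, v, hl, hl1, hsum, hbin⟩ := exists_binary_convex_combination p q z
    (fun k => hχ _ _ k) (fun k => hχ _ _ k)
    (fun k => by simpa [p, q] using hχ S₁ S₂ k) x s t hzst hx01
  let y : Fin 3 → Fin n → ℤ := fun k i => z i + u k * p i + v k * q i
  let T : Fin 3 → Finset (Fin n) := fun k => Finset.univ.filter fun i => y k i = 1
  have hyT : ∀ k, 0 < l k → ∀ i, y k i = χ (T k) i := by
    intro k hk i
    rcases hbin k hk i with h | h <;> simp [χ, T, y, h]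
  have hcT : ∀ k, 0 < l k → ∑ i ∈ T k, c i = ∑ i, c i * (z i : ℝ) := by
    intro k hk
    rw [← hχc]
    calc ∑ i, c i * (χ (T k) i : ℝ)
        = ∑ i, (c i * (z i : ℝ) + u k * (c i * (p i : ℝ)) + v k * (c i * (q i : ℝ))) := by
          refine Finset.sum_congr rfl fun i _ => ?_
          rw [← hyT k hk i]
          simp only [y]
          push_cast
          ring
      _ = _ := by
          rw [Finset.sum_add_distrib, Finset.sum_add_distrib, ← Finset.mul_sum, ← Finset.mul_sum,
            hcp, hcq]
          ring
  have haT : ∀ k, 0 < l k → ∑ i, (a i : ℝ) * y k i = ((∑ i ∈ T k, a i : ℤ) : ℝ) := by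
    intro k hk
    simp [hyT k hk, χ]
  have hax : ∑ i, (a i : ℝ) * x i = ∑ k, l k * ∑ i, (a i : ℝ) * y k i := by
    simp only [Finset.mul_sum]
    rw [Finset.sum_comm]
    refine Finset.sum_congr rfl fun i _ => ?_
    rw [hsum i, Finset.mul_sum]
    exact Finset.sum_congr rfl fun k _ => by ring
  -- Not all binary points that are used can violate the knapsack inequality strictly.
  obtain ⟨k₀, hk₀, hk₀F⟩ : ∃ k, 0 < l k ∧ ∑ i ∈ T k, a i ≤ b := by
    by_contra! hall
    have hle : ∀ k, l k * b ≤ l k * ∑ i, (a i : ℝ) * y k i := by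
      intro k
      rcases (hl k).eq_or_lt with h | h
      · simp [← h]
      · rw [haT k h]
        exact mul_le_mul_of_nonneg_left (by exact_mod_cast (hall k h).le) h.le
    obtain ⟨k, hk⟩ : ∃ k, 0 < l k := by
      by_contra! h
      linarith [Finset.sum_nonpos fun k (_ : k ∈ Finset.univ) => h k]
    have hlt : ∑ k, l k * (b : ℝ) < ∑ k, l k * ∑ i, (a i : ℝ) * y k i := by
      refine Finset.sum_lt_sum (fun k _ => hle k) ⟨k, Finset.mem_univ _, ?_⟩
      rw [haT k hk]
      exact mul_lt_mul_of_pos_left (by exact_mod_cast hall k hk) hk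
    rw [← Finset.sum_mul, hl1, one_mul, ← hax] at hlt
    linarith
  have hxeq : x = ∑ k ∈ Finset.univ.filter (fun k => 0 < l k), l k • fun i => (y k i : ℝ) := by
    have hzero : ∀ k, l k • (fun i => (y k i : ℝ)) ≠ 0 → 0 < l k := fun k hk =>
      (hl k).lt_of_ne fun h => hk (by simp [← h])
    rw [Finset.sum_filter_of_ne fun k _ => hzero k]
    ext i
    simp [hsum i, y]
  rw [hxeq]
  refine (convex_convexHull ℝ _).sum_mem (fun k _ => hl k) ?_ fun k hk => subset_convexHull ℝ _ ?_
  · rw [Finset.sum_filter_of_ne fun k _ h => (hl k).lt_of_ne h.symm, hl1]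
  have hk : 0 < l k := (Finset.mem_filter.1 hk).2
  refine ⟨⟨fun i => ?_, ?_⟩, fun i => ⟨y k i, rfl⟩⟩
  · rcases hbin k hk i with h | h <;> simp [y, h]
  · rw [haT k hk]
    exact_mod_cast hc _ _ ((hcT k₀ hk₀).trans (hcT k hk).symm) hk₀F

theorem theorem6 (n : ℕ) (hn : 4 ≤ n) (a : Fin n → ℤ) (b : ℤ) :
    ∃ W : Matrix (Fin (n - 2)) (Fin n) ℤ, MixedIntegerProperty (knapsackPolytope a b) W := by
  obtain ⟨c, hc, S₁, S₂, S₃, h12, h13, h23, e13, e23⟩ := exists_separating_weight hn a b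
  -- Each set is told apart from the other two by some coordinate, with at most one exception;
  -- the exceptional set, if any, takes the role of the third one.
  obtain ⟨i, hi⟩ : ∃ i, ¬ (i ∈ S₁ ↔ i ∈ S₂) := by
    by_contra! h
    exact h12 (Finset.ext h)
  obtain ⟨j, hj⟩ : ∃ j, ¬ (j ∈ S₁ ↔ j ∈ S₃) := by
    by_contra! h
    exact h13 (Finset.ext h)
  obtain ⟨k, hk⟩ : ∃ k, ¬ (k ∈ S₂ ↔ k ∈ S₃) := by
    by_contra! h
    exact h23 (Finset.ext h)
  have main := exists_reformulation_of_equal_weight a b c hc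
  by_cases hi3 : i ∈ S₂ ↔ i ∈ S₃
  · by_cases hk1 : k ∈ S₁ ↔ k ∈ S₃
    · refine main S₁ S₂ S₃ e13 e23 i k ?_ ?_ ?_ ?_ <;> grind
    · refine main S₁ S₃ S₂ (e13.trans e23.symm) e23.symm i k ?_ ?_ ?_ ?_ <;> grind
  · by_cases hj2 : j ∈ S₂ ↔ j ∈ S₃
    · refine main S₁ S₂ S₃ e13 e23 j i ?_ ?_ ?_ ?_ <;> grind
    · refine main S₂ S₃ S₁ (e23.trans e13.symm) e13.symm i j ?_ ?_ ?_ ?_ <;> grind
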